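/- Let $R=\mathbb{F}_2[[x,y,z]]$, let \[ T=\begin{pmatrix} 0&y+z&z&z+y^2&z\\ y+z&0&x&x+y+z&x+y+z+z^2\\ z&x&0&z&x+z\\ z+y^2&x+y+z&z&0&x^2\\ z&x+y+z+z^2&x+z&x^2&0 \end{pmatrix}, \] and let $I$ be the ideal of $R$ generated by the five submaximal pfaffians $\mathrm{pf}_i(T)$, $i=1,\dots,5$, where $\mathrm{pf}_i(T)$ is the pfaffian of the $4\times 4$ matrix obtained from $T$ by removing the $i$-th row and the $i$-th column. Then $I$ is a Gorenstein ideal (that is, $R/I$ is a Gorenstein local ring) of grade $3$ (that is, the supremum of the lengths of $R$-regular sequences contained in $I$ is $3$), and $I$ is minimally generated by five elements (that is, the minimal number of generators of $I$ is $5$). -/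

import Mathlib

/-- The pfaffian of a square matrix (to be used for alternating matrices, i.e. skew-symmetric
matrices with zeros on the diagonal), by expansion along the first row:
`pf A = ∑ j, (-1) ^ j * A 0 (j + 1) * pf (A with rows and columns 0 and j + 1 removed)`.
The pfaffian of the empty matrix is `1` and that of a `1 × 1` matrix is `0`. -/
def pfaffian {R : Type*} [CommRing R] : {n : ℕ} → Matrix (Fin n) (Fin n) R → R
  | 0, _ => 1
  | 1, _ => 0
  | n + 2, A => ∑ j : Fin (n + 1), (-1) ^ (j : ℕ) * A 0 j.succ *
      pfaffian (A.submatrix (fun i => (j.succAbove i).succ) (fun i => (j.succAbove i).succ))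

/-- The `i`-th submaximal pfaffian: the pfaffian of the submatrix obtained by removing the row and
the column in position `i`. -/
def submaximalPfaffian {R : Type*} [CommRing R] {n : ℕ}
    (A : Matrix (Fin (n + 1)) (Fin (n + 1)) R) (i : Fin (n + 1)) : R :=
  pfaffian (A.submatrix i.succAbove i.succAbove)

/-- The grade of an ideal `I` of `R`: the supremum of the lengths of the `R`-regular sequences
contained in `I`. For `I ≠ R` every weakly regular sequence in `I` is regular; for `I = R` one
gets the usual convention `grade R = ∞`. -/
noncomputable def idealGrade {R : Type*} [CommRing R] (I : Ideal R) : ℕ∞ :=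
  ⨆ (rs : List R) (_ : ∀ r ∈ rs, r ∈ I) (_ : RingTheory.Sequence.IsWeaklyRegular R rs),
    (rs.length : ℕ∞)

/-- A Gorenstein local ring: a Noetherian local ring of finite injective dimension as a module
over itself. -/
structure IsGorensteinLocalRing (A : Type*) [CommRing A] : Prop where
  isNoetherianRing : IsNoetherianRing A
  isLocalRing : IsLocalRing A
  finite_injectiveDimension :
    ∃ d : ℕ, CategoryTheory.HasInjectiveDimensionLE (ModuleCat.of A A) d

/-- A Gorenstein ideal of a (regular) local ring: an ideal whose quotient ring is Gorenstein. -/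
def IsGorensteinIdeal {R : Type*} [CommRing R] (I : Ideal R) : Prop :=
  IsGorensteinLocalRing (R ⧸ I)

/-- The ring `𝔽₂⟦x, y, z⟧`. -/
abbrev F2xyz : Type := MvPowerSeries (Fin 3) (ZMod 2)

/-- The explicit `5 × 5` skew-symmetric matrix `T` over `𝔽₂⟦x, y, z⟧`. -/
noncomputable def matrixT : Matrix (Fin 5) (Fin 5) F2xyz :=
  let x : F2xyz := MvPowerSeries.X 0
  let y : F2xyz := MvPowerSeries.X 1
  let z : F2xyz := MvPowerSeries.X 2
  !![0,       y + z,             z,     z + y ^ 2, z;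
     y + z,   0,                 x,     x + y + z, x + y + z + z ^ 2;
     z,       x,                 0,     z,         x + z;
     z + y ^ 2, x + y + z,       z,     0,         x ^ 2;
     z,       x + y + z + z ^ 2, x + z, x ^ 2,     0]

/-- The ideal `I` generated by the five submaximal pfaffians of `T`. -/
noncomputable def idealI : Ideal F2xyz :=
  Ideal.span (Set.range (submaximalPfaffian matrixT))

/-!
`I` is the largest ideal contained in the kernel of a single linear form `φ` on `R` (an instance of
Macaulay's inverse systems). Modulo `I` every power series is a combination of thirteen standard
monomials, and `φ` pairs these monomials with a dual family of polynomials. As `φ` induces a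
nondegenerate pairing on the finite-dimensional algebra `R ⧸ I`, every functional on an ideal of
`R ⧸ I` is given by multiplication by an element, and Baer's criterion shows that `R ⧸ I` is
self-injective, hence Gorenstein. The regular sequence `x ^ 2, y ^ 5, z ^ 6` lies in `I`, and the
grade cannot exceed the Krull dimension of `R`. Five linear forms, semilinear over the residue
field when restricted to `I`, are dual to five generators, so none of these can be spared.
-/

open IsLocalRing MvPowerSeries RingTheory.Sequence

section FormIdeal

variable {k A : Type*} [Field k] [CommRing A] [Algebra k A]

/-- The largest ideal contained in the kernel of a linear form. If `A` is a power series ring and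
`φ` is continuous, this is the ideal of Macaulay's inverse system generated by `φ`. -/
def formIdeal (φ : A →ₗ[k] k) : Ideal A where
  carrier := {r | ∀ a, φ (a * r) = 0}
  add_mem' hr hs a := by rw [mul_add, map_add, hr, hs, add_zero]
  zero_mem' a := by rw [mul_zero, map_zero]
  smul_mem' b r hr a := by rw [smul_eq_mul, ← mul_assoc, hr]

theorem mem_formIdeal {φ : A →ₗ[k] k} {r : A} : r ∈ formIdeal φ ↔ ∀ a, φ (a * r) = 0 :=
  Iff.rfl

theorem formIdeal_ne_top {φ : A →ₗ[k] k} (hφ : φ ≠ 0) : formIdeal φ ≠ ⊤ := by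
  contrapose! hφ
  ext a
  simpa using mem_formIdeal.1 ((Ideal.eq_top_iff_one _).1 hφ) a

theorem baer_self_of_formIdeal_eq_bot [Module.Finite k A] {φ : A →ₗ[k] k}
    (hφ : formIdeal φ = ⊥) : Module.Baer A A := by
  have nondegenerate {a : A} (h : ∀ b, φ (b * a) = 0) : a = 0 := by
    simpa [hφ] using mem_formIdeal.2 h
  let pairing : A →ₗ[k] Module.Dual k A := (LinearMap.mul k A).compr₂ φ
  have pairing_injective : Function.Injective pairing :=
    (injective_iff_map_eq_zero _).2 fun a ha =>
      nondegenerate fun b => by rw [mul_comm]; exact LinearMap.congr_fun ha b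
  have pairing_surjective : Function.Surjective pairing :=
    (LinearMap.injective_iff_surjective_of_finrank_eq_finrank
      Subspace.dual_finrank_eq.symm).1 pairing_injective
  intro J f
  obtain ⟨ψ, hψ⟩ := LinearMap.exists_extend (p := J.restrictScalars k) (φ ∘ₗ f.restrictScalars k)
  obtain ⟨c, rfl⟩ := pairing_surjective ψ
  have hc (x : J) : φ (c * x) = φ (f x) := LinearMap.congr_fun hψ x
  refine ⟨LinearMap.mulLeft A c, fun x hx => sub_eq_zero.1 (nondegenerate fun b => ?_)⟩
  calc φ (b * (c * x - f ⟨x, hx⟩)) = φ (c * (b * x)) - φ (b * f ⟨x, hx⟩) := by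
        rw [← map_sub]; congr 1; ring
    _ = φ (c * (b • ⟨x, hx⟩ : J)) - φ (f (b • ⟨x, hx⟩)) := by rw [map_smul]; rfl
    _ = 0 := by rw [hc, sub_self]

theorem exists_form_quotient_formIdeal (φ : A →ₗ[k] k) :
    ∃ ψ : A ⧸ formIdeal φ →ₗ[k] k, ∀ a, ψ (Ideal.Quotient.mk _ a) = φ a :=
  ⟨((formIdeal φ).restrictScalars k).liftQ φ
    (fun r hr => by simpa using mem_formIdeal.1 hr 1) ∘ₗ
      (Submodule.Quotient.restrictScalarsEquiv k (formIdeal φ)).symm.toLinearMap, fun _ => rfl⟩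

theorem baer_quotient_formIdeal (φ : A →ₗ[k] k) [Module.Finite k (A ⧸ formIdeal φ)] :
    Module.Baer (A ⧸ formIdeal φ) (A ⧸ formIdeal φ) := by
  obtain ⟨ψ, hψ⟩ := exists_form_quotient_formIdeal φ
  refine baer_self_of_formIdeal_eq_bot (φ := ψ) ((Submodule.eq_bot_iff _).2 fun a ha => ?_)
  obtain ⟨r, rfl⟩ := Ideal.Quotient.mk_surjective a
  refine Ideal.Quotient.eq_zero_iff_mem.2 (mem_formIdeal.2 fun b => ?_)
  rw [← hψ, map_mul, mem_formIdeal.1 ha]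

theorem isGorensteinIdeal_formIdeal [IsLocalRing A] {φ : A →ₗ[k] k}
    [Module.Finite k (A ⧸ formIdeal φ)] (hφ : φ ≠ 0) : IsGorensteinIdeal (formIdeal φ) where
  isNoetherianRing := .of_finite k _
  isLocalRing :=
    have := Ideal.Quotient.nontrivial_iff.2 (formIdeal_ne_top hφ)
    .of_surjective' (Ideal.Quotient.mk _) Ideal.Quotient.mk_surjective
  finite_injectiveDimension := by
    have := (baer_quotient_formIdeal φ).injective
    have := Module.injective_object_of_injective_module (A ⧸ formIdeal φ) (A ⧸ formIdeal φ)
    exact ⟨0, inferInstance⟩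

theorem formIdeal_le_of_dual_family {ι : Type*} [Finite ι] [DecidableEq ι] {φ : A →ₗ[k] k}
    {I : Ideal A} (hI : I ≤ formIdeal φ) {b c : ι → A}
    (hb : Submodule.span k (Set.range (Ideal.Quotient.mkₐ k I ∘ b)) = ⊤)
    (hbc : ∀ i j, φ (c i * b j) = if i = j then 1 else 0) : formIdeal φ ≤ I := by
  cases nonempty_fintype ι
  intro r hr
  obtain ⟨t, ht⟩ := (Submodule.mem_span_range_iff_exists_fun k).1
    (hb ▸ Submodule.mem_top (x := Ideal.Quotient.mkₐ k I r))
  have hmem : r - ∑ j, t j • b j ∈ I := by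
    rw [← Ideal.Quotient.eq_zero_iff_mem, ← Ideal.Quotient.mkₐ_eq_mk k, map_sub, ← ht]
    simp
  have ht0 (i : ι) : t i = 0 := by
    have h := mem_formIdeal.1 (hI hmem) (c i)
    simpa [mul_sub, mem_formIdeal.1 hr, Finset.mul_sum, hbc] using h
  simpa [ht0] using hmem

end FormIdeal

theorem spanRank_span_range_of_dual_forms {R M k ι : Type*} [CommRing R] [AddCommGroup M]
    [Module R M] [Field k] [Fintype ι] [DecidableEq ι] {ε : R →+* k} (hε : Function.Surjective ε)
    {g : ι → M} (L : M →+ (ι → k)) (hL : ∀ i a, L (a • g i) = Pi.single i (ε a)) :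
    (Submodule.span R (Set.range g)).spanRank = Fintype.card ι := by
  apply le_antisymm
  · refine (Submodule.spanRank_span_le_card _).trans ?_
    simpa using Cardinal.mk_range_le_lift (f := g)
  · have : RingHomSurjective ε := ⟨hε⟩
    have hL' {m : M} (hm : m ∈ Submodule.span R (Set.range g)) (a : R) : L (a • m) = ε a • L m := by
      induction hm using Submodule.span_induction generalizing a with
      | mem m hm =>
        obtain ⟨i, rfl⟩ := hm
        have := hL i 1
        rw [one_smul, map_one] at this
        rw [hL, this, ← Pi.single_smul, smul_eq_mul, mul_one]
      | zero => simp
      | add m n _ _ hm hn => rw [smul_add, map_add, hm, hn, map_add, smul_add]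
      | smul b m _ hm => rw [smul_smul, hm, hm, map_mul, mul_smul]
    let Λ : Submodule.span R (Set.range g) →ₛₗ[ε] (ι → k) :=
      { toFun m := L m
        map_add' _ _ := map_add L _ _
        map_smul' a m := hL' m.2 a }
    have hΛ : (⊤ : Submodule R (Submodule.span R (Set.range g))).map Λ = ⊤ := by
      rw [Submodule.map_top, LinearMap.range_eq_top]
      intro v
      choose a ha using fun i => hε (v i)
      have hmem (i : ι) : a i • g i ∈ Submodule.span R (Set.range g) :=
        Submodule.smul_mem _ _ (Submodule.subset_span ⟨i, rfl⟩)
      refine ⟨⟨∑ i, a i • g i, sum_mem fun i _ => hmem i⟩, ?_⟩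
      change L (∑ i, a i • g i) = v
      simp only [map_sum, hL, ha, Finset.univ_sum_single]
    have h := Submodule.lift_spanRank_map_le Λ ⊤
    rw [hΛ, ← Submodule.rank_eq_spanRank_of_free] at h
    simpa using h

theorem idealGrade_le_ringKrullDim {R : Type*} [CommRing R] [IsNoetherianRing R] [IsLocalRing R]
    {I : Ideal R} (hI : I ≠ ⊤) : (idealGrade I : WithBot ℕ∞) ≤ ringKrullDim R := by
  rw [← maximalIdeal_height_eq_ringKrullDim]
  refine WithBot.coe_le_coe.2 (iSup_le fun rs => iSup_le fun hrs => iSup_le fun hreg => ?_)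
  rw [← WithBot.coe_le_coe, maximalIdeal_height_eq_ringKrullDim]
  have hregular : IsRegular R rs := .of_isWeaklyRegular_of_mem_maximalIdeal _
    (fun r hr => le_maximalIdeal hI (hrs r hr)) hreg
  have : Nontrivial (R ⧸ Ideal.ofList rs) :=
    Ideal.Quotient.nontrivial_iff.2 fun h => hregular.2 (by simp [h])
  rw [← ringKrullDim_add_length_eq_ringKrullDim_of_isRegular rs hregular]
  exact le_add_of_nonneg_left ringKrullDim_nonneg_of_nontrivial

section PowersOfVariables

variable {σ k : Type*} [CommRing k]

theorem exists_eq_add_X_pow_mul (s : σ) (m : ℕ) (f : MvPowerSeries σ k) :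
    ∃ g h, f = g + X s ^ m * h ∧ ∀ n, coeff n g = if n s < m then coeff n f else 0 := by
  let g : MvPowerSeries σ k := fun n => if n s < m then coeff n f else 0
  have hg (n) : coeff n g = if n s < m then coeff n f else 0 := rfl
  obtain ⟨h, hh⟩ : X s ^ m ∣ f - g :=
    X_pow_dvd_iff.2 fun n hn => by rw [map_sub, hg, if_pos hn, sub_self]
  exact ⟨g, h, by rw [← hh, add_sub_cancel], hg⟩

theorem mem_span_image_X_pow_iff {T : Set σ} (hT : T.Finite) {e : σ → ℕ} {f : MvPowerSeries σ k} :
    f ∈ Ideal.span ((fun s => X s ^ e s) '' T) ↔ ∀ n, (∀ s ∈ T, n s < e s) → coeff n f = 0 := by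
  induction T, hT using Set.Finite.induction_on generalizing f with
  | empty => simp [MvPowerSeries.ext_iff]
  | insert _ _ ih =>
    rename_i s T _ _
    simp only [Set.image_insert_eq, Set.forall_mem_insert]
    constructor
    · intro hf n hn
      obtain ⟨a, b, hb, rfl⟩ := Ideal.mem_span_insert.1 hf
      rw [map_add, X_pow_dvd_iff.1 (dvd_mul_left _ a) n hn.1, ih.1 hb n hn.2, add_zero]
    · intro hf
      obtain ⟨g, h, rfl, hg⟩ := exists_eq_add_X_pow_mul s (e s) f
      have hgT : g ∈ Ideal.span ((fun s => X s ^ e s) '' T) := ih.2 fun n hn => by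
        rw [hg]
        split_ifs with hs
        exacts [hf n ⟨hs, hn⟩, rfl]
      exact Ideal.mem_span_insert.2 ⟨h, g, hgT, by ring⟩

theorem coeff_add_single_X_pow_mul (s : σ) (m : ℕ) (n : σ →₀ ℕ) (f : MvPowerSeries σ k) :
    coeff (n + Finsupp.single s m) (X s ^ m * f) = coeff n f := by
  rw [X_pow_eq, add_comm, coeff_add_monomial_mul, one_mul]

theorem isWeaklyRegular_map_X_pow {l : List σ} (hl : l.Nodup) (e : σ → ℕ) :
    IsWeaklyRegular (MvPowerSeries σ k) (l.map fun s => X s ^ e s : List (MvPowerSeries σ k)) := by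
  refine ⟨fun i hi => ?_⟩
  rw [List.length_map] at hi
  have hspan : Ideal.ofList ((l.map fun s => (X s ^ e s : MvPowerSeries σ k)).take i) =
      Ideal.span ((fun s => X s ^ e s) '' {s | s ∈ l.take i}) := by
    rw [← List.map_take, Ideal.ofList]
    simp only [List.mem_map]
    rfl
  have hnotMem : l[i] ∉ l.take i := by
    rw [List.mem_take_iff_getElem]
    rintro ⟨j, hj, hji⟩
    have := hl.getElem_inj_iff.1 hji
    omega
  rw [isSMulRegular_on_quot_iff_lsmul_comap_le]
  intro f hf
  rw [Submodule.mem_comap, LinearMap.lsmul_apply] at hf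
  simp only [smul_eq_mul, Ideal.mul_top, List.getElem_map, hspan,
    mem_span_image_X_pow_iff (List.finite_toSet _)] at hf ⊢
  intro n hn
  rw [← coeff_add_single_X_pow_mul l[i] (e l[i])]
  refine hf _ fun s hs => ?_
  rw [Finsupp.add_apply, Finsupp.single_eq_of_ne (by grind), add_zero]
  exact hn s hs

theorem mem_span_range_X_iff [Finite σ] {f : MvPowerSeries σ k} :
    f ∈ Ideal.span (Set.range X) ↔ constantCoeff f = 0 := by
  have h := mem_span_image_X_pow_iff (Set.toFinite Set.univ) (e := fun _ : σ => 1) (f := f)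
  simp only [pow_one, Set.image_univ, Set.mem_univ, forall_const, Nat.lt_one_iff] at h
  rw [h, ← coeff_zero_eq_constantCoeff_apply]
  exact ⟨fun h => h 0 fun _ => rfl, fun h n hn => by rwa [Finsupp.ext (g := 0) hn]⟩

theorem exists_mvPolynomial_map_eq [Finite σ] {A : Type*} [CommRing A] {π : MvPowerSeries σ k →+* A}
    (hπ : ∀ s, IsNilpotent (π (X s))) (f : MvPowerSeries σ k) :
    ∃ p : MvPolynomial σ k, π p = π f := by
  classical
  choose e he using hπ
  have hspan : Ideal.span ((fun s => X s ^ e s) '' Set.univ) ≤ RingHom.ker π := by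
    rw [Ideal.span_le]
    rintro _ ⟨s, -, rfl⟩
    exact (map_pow π _ _).trans (he s)
  refine ⟨trunc' k (Finsupp.equivFunOnFinite.symm e) f, (sub_eq_zero.1 ?_).symm⟩
  rw [← map_sub]
  refine hspan ((mem_span_image_X_pow_iff Set.finite_univ).2 fun n hn => ?_)
  have hne : n ≤ Finsupp.equivFunOnFinite.symm e := fun s => (hn s trivial).le
  rw [map_sub, MvPolynomial.coeff_coe, coeff_trunc', if_pos hne, sub_self]

theorem eq_top_of_X_mul_mem [Finite σ] {A : Type*} [CommRing A] [Algebra k A]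
    {π : MvPowerSeries σ k →ₐ[k] A} (hπ : Function.Surjective π)
    (hnil : ∀ s, IsNilpotent (π (X s))) {W : Submodule k A} (one_mem : 1 ∈ W)
    (X_mul_mem : ∀ s, ∀ w ∈ W, π (X s) * w ∈ W) : W = ⊤ := by
  refine eq_top_iff.2 fun a _ => ?_
  obtain ⟨f, rfl⟩ := hπ a
  obtain ⟨p, hp⟩ := exists_mvPolynomial_map_eq (π := (π : MvPowerSeries σ k →+* A)) hnil f
  rw [RingHom.coe_coe] at hp
  rw [← hp]
  clear hp
  induction p using MvPolynomial.induction_on with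
  | C c =>
    have : π (MvPolynomial.C c : MvPolynomial σ k) = c • (1 : A) := by
      rw [MvPolynomial.coe_C, ← Algebra.algebraMap_eq_smul_one, ← π.commutes]; rfl
    exact this ▸ W.smul_mem c one_mem
  | add p q hp hq => simpa using add_mem hp hq
  | mul_X p s hp => simpa [mul_comm] using X_mul_mem s _ hp

end PowersOfVariables

theorem ringKrullDim_mvPowerSeries_le (σ k : Type*) [Finite σ] [Field k] :
    ringKrullDim (MvPowerSeries σ k) ≤ Nat.card σ := by
  have hspan : maximalIdeal (MvPowerSeries σ k) = Ideal.span (Set.range X) := by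
    ext f
    rw [mem_span_range_X_iff, mem_maximalIdeal, mem_nonunits_iff, isUnit_iff_constantCoeff,
      isUnit_iff_ne_zero, not_not]
  have hrank : (maximalIdeal (MvPowerSeries σ k)).spanFinrank ≤ Nat.card σ := by
    rw [hspan]
    refine (Submodule.spanFinrank_span_le_ncard_of_finite (Set.finite_range _)).trans ?_
    rw [← Nat.card_coe_set_eq]
    exact Finite.card_range_le _
  exact (ringKrullDim_le_spanFinrank_maximalIdeal _).trans (by exact_mod_cast hrank)

theorem span_range_mulVec_le {R m n : Type*} [CommRing R] [Fintype n] (M : Matrix m n R)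
    (g : n → R) : Ideal.span (Set.range (M.mulVec g)) ≤ Ideal.span (Set.range g) := by
  rw [Ideal.span_le, Set.range_subset_iff]
  exact fun i => sum_mem fun j _ => Ideal.mul_mem_left _ (M i j) (Ideal.subset_span ⟨j, rfl⟩)

theorem span_range_mulVec {R n : Type*} [CommRing R] [Fintype n] [DecidableEq n]
    {M : Matrix n n R} (hM : IsUnit M.det) (g : n → R) :
    Ideal.span (Set.range (M.mulVec g)) = Ideal.span (Set.range g) := by
  refine le_antisymm (span_range_mulVec_le M g) ?_
  simpa [M.nonsing_inv_mul hM] using span_range_mulVec_le M⁻¹ (M.mulVec g)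

section Coefficients

variable {k : Type*} [CommRing k]

/-- The coefficient of `x ^ a * y ^ b * z ^ c`. -/
noncomputable def coeff₃ (a b c : ℕ) : MvPowerSeries (Fin 3) k →ₗ[k] k :=
  coeff (Finsupp.single 0 a + Finsupp.single 1 b + Finsupp.single 2 c)

theorem coeff_X_mul_eq_ite {σ : Type*} (n : σ →₀ ℕ) (s : σ) (f : MvPowerSeries σ k) :
    coeff n (X s * f) = if n s = 0 then 0 else coeff (n - Finsupp.single s 1) f := by
  classical
  rw [X, coeff_monomial_mul, one_mul]
  simp only [Finsupp.single_le_iff, Nat.one_le_iff_ne_zero, ite_not]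

theorem coeff₃_X_zero_mul (a b c : ℕ) (f : MvPowerSeries (Fin 3) k) :
    coeff₃ a b c (X 0 * f) = if a = 0 then 0 else coeff₃ (a - 1) b c f := by
  rw [coeff₃, coeff_X_mul_eq_ite, coeff₃]
  congr 3
  · simp
  · ext i; fin_cases i <;> simp

theorem coeff₃_X_one_mul (a b c : ℕ) (f : MvPowerSeries (Fin 3) k) :
    coeff₃ a b c (X 1 * f) = if b = 0 then 0 else coeff₃ a (b - 1) c f := by
  rw [coeff₃, coeff_X_mul_eq_ite, coeff₃]
  congr 3
  · simp
  · ext i; fin_cases i <;> simp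

theorem coeff₃_X_two_mul (a b c : ℕ) (f : MvPowerSeries (Fin 3) k) :
    coeff₃ a b c (X 2 * f) = if c = 0 then 0 else coeff₃ a b (c - 1) f := by
  rw [coeff₃, coeff_X_mul_eq_ite, coeff₃]
  congr 3
  · simp
  · ext i; fin_cases i <;> simp

theorem coeff₃_zero (f : MvPowerSeries (Fin 3) k) : coeff₃ 0 0 0 f = constantCoeff f := by
  simp [coeff₃]

end Coefficients

/-- The monomial `x ^ a * y ^ b * z ^ c` for `e = (a, b, c)`. -/
def monomial₃ {A : Type*} [CommRing A] (x y z : A) (e : ℕ × ℕ × ℕ) : A :=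
  x ^ e.1 * y ^ e.2.1 * z ^ e.2.2

theorem monomial₃_add {A : Type*} [CommRing A] (x y z : A) (d e : ℕ × ℕ × ℕ) :
    monomial₃ x y z (d + e) = monomial₃ x y z d * monomial₃ x y z e := by
  simp only [monomial₃, Prod.fst_add, Prod.snd_add, pow_add]
  ring

theorem coeff₃_monomial₃ {k : Type*} [CommRing k] (a b c : ℕ) (e : ℕ × ℕ × ℕ) :
    coeff₃ a b c (monomial₃ (X 0) (X 1) (X 2) e : MvPowerSeries (Fin 3) k) =
      if e = (a, b, c) then 1 else 0 := by
  classical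
  rw [monomial₃, X_pow_eq, X_pow_eq, X_pow_eq, monomial_mul_monomial, monomial_mul_monomial,
    coeff₃, coeff_monomial, one_mul, one_mul]
  congr 1
  simp [Finsupp.ext_iff, Fin.forall_fin_succ, Prod.ext_iff, eq_comm]

/-- Generators of `idealI` obtained from its submaximal pfaffians by row operations. -/
noncomputable def reducedGenerators : Fin 5 → F2xyz :=
  ![X 0 ^ 2, X 0 * X 2 + X 1 ^ 2 * X 2, X 0 * X 1 + X 0 * X 2 + X 2 ^ 3,
    X 1 ^ 3 + X 2 ^ 3 + X 1 ^ 2 * X 2 + X 1 ^ 2 * X 2 ^ 2, X 0 * X 1 ^ 2]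

theorem pfaffian_four {R : Type*} [CommRing R] (A : Matrix (Fin 4) (Fin 4) R) :
    pfaffian A = A 0 1 * A 2 3 - A 0 2 * A 1 3 + A 0 3 * A 1 2 := by
  simp [pfaffian, Fin.sum_univ_succ, Fin.succAbove]
  ring

theorem two_eq_zero_of_algebra_zmod_two (A : Type*) [CommRing A] [Algebra (ZMod 2) A] :
    (2 : A) = 0 := by
  rw [← map_ofNat (algebraMap (ZMod 2) A), show (OfNat.ofNat 2 : ZMod 2) = 0 by decide, map_zero]

/-- The coefficients of the submaximal pfaffians of `matrixT` in terms of `reducedGenerators`. -/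
noncomputable def pfaffianCoefficients : Matrix (Fin 5) (Fin 5) F2xyz :=
  !![1 + X 0,   0, 1, 0, 0;
     X 2,       1, 0, 0, 1;
     X 1 + X 2, 0, 0, 1, 1;
     0,         0, 1, 0, 0;
     0,         0, 0, 0, 1]

theorem submaximalPfaffian_matrixT :
    submaximalPfaffian matrixT = pfaffianCoefficients.mulVec reducedGenerators := by
  have h₂ := two_eq_zero_of_algebra_zmod_two F2xyz
  funext i
  rw [submaximalPfaffian, pfaffian_four]
  fin_cases i <;>
    simp [matrixT, reducedGenerators, pfaffianCoefficients, Matrix.mulVec, dotProduct,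
      Fin.sum_univ_succ, Fin.succAbove] <;> grind

theorem isUnit_det_pfaffianCoefficients : IsUnit pfaffianCoefficients.det := by
  have hmap : constantCoeff.mapMatrix pfaffianCoefficients =
      !![(1 : ZMod 2), 0, 1, 0, 0;
         0, 1, 0, 0, 1;
         0, 0, 0, 1, 1;
         0, 0, 1, 0, 0;
         0, 0, 0, 0, 1] := by
    ext i j
    fin_cases i <;> fin_cases j <;> simp [pfaffianCoefficients]
  rw [isUnit_iff_constantCoeff, RingHom.map_det, hmap]
  simp [Matrix.det_succ_row_zero, Fin.sum_univ_succ, Fin.succAbove]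

theorem idealI_eq_span_reducedGenerators : idealI = Ideal.span (Set.range reducedGenerators) := by
  rw [idealI, submaximalPfaffian_matrixT, span_range_mulVec isUnit_det_pfaffianCoefficients]

/-- The relations between the images of the variables in a quotient of `F2xyz` by an ideal
containing `reducedGenerators`, solved for the nonstandard monomials. -/
structure ReducedRelations {A : Type*} [CommRing A] (x y z : A) : Prop where
  two_eq_zero : (2 : A) = 0
  x_sq : x ^ 2 = 0
  x_mul_z : x * z = y ^ 2 * z
  x_mul_y : x * y = y ^ 2 * z + z ^ 3
  y_cube : y ^ 3 = z ^ 3 + y ^ 2 * z + y ^ 2 * z ^ 2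
  x_mul_y_sq : x * y ^ 2 = 0

/-- The exponents of monomials in `x, y, z` that form a basis of the quotient by `idealI`. -/
def standardExponent : Fin 13 → ℕ × ℕ × ℕ :=
  ![(0, 0, 0), (1, 0, 0), (0, 1, 0), (0, 0, 1), (0, 2, 0), (0, 1, 1), (0, 0, 2), (0, 2, 1),
    (0, 1, 2), (0, 0, 3), (0, 2, 2), (0, 0, 4), (0, 0, 5)]

namespace ReducedRelations

variable {A : Type*} [CommRing A] {x y z : A} (h : ReducedRelations x y z)
include h

theorem x_mul_z_cube : x * z ^ 3 = 0 := by
  linear_combination y * h.x_sq - x * h.x_mul_y - z * h.x_mul_y_sq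

theorem y_sq_mul_z_cube : y ^ 2 * z ^ 3 = 0 := by
  linear_combination h.x_mul_z_cube - z ^ 2 * h.x_mul_z

theorem y_cube_mul_z : y ^ 3 * z = y ^ 2 * z ^ 2 + z ^ 4 := by
  linear_combination z * h.y_cube + h.y_sq_mul_z_cube

theorem y_mul_z_cube : y * z ^ 3 = y ^ 2 * z ^ 2 + z ^ 4 := by
  linear_combination h.x_mul_y_sq - y * h.x_mul_y - h.y_cube_mul_z -
    (y ^ 2 * z ^ 2 + z ^ 4) * h.two_eq_zero

theorem y_cube_mul_z_sq : y ^ 3 * z ^ 2 = z ^ 5 := by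
  linear_combination z * h.y_cube_mul_z + h.y_sq_mul_z_cube

theorem y_mul_z_pow_four : y * z ^ 4 = z ^ 5 := by
  linear_combination z * h.y_mul_z_cube + h.y_sq_mul_z_cube

theorem z_pow_six : z ^ 6 = 0 := by
  linear_combination y * h.y_sq_mul_z_cube - z * h.y_cube_mul_z_sq

theorem y_pow_four : y ^ 4 = z ^ 5 := by
  linear_combination y * h.y_cube + h.y_mul_z_cube + h.y_cube_mul_z + h.y_cube_mul_z_sq +
    (y ^ 2 * z ^ 2 + z ^ 4) * h.two_eq_zero

theorem y_pow_five : y ^ 5 = 0 := by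
  linear_combination y * h.y_pow_four + z * h.y_mul_z_pow_four + h.z_pow_six

theorem x_mul_monomial₃ (i : Fin 13) : x * monomial₃ x y z (standardExponent i) =
    ∑ j ∈ ![{1}, ∅, {7, 9}, {7}, ∅, {10, 11}, {10}, ∅, {12}, ∅, ∅, ∅, ∅] i,
      monomial₃ x y z (standardExponent j) := by
  fin_cases i <;> simp only [monomial₃, standardExponent, Fin.reduceFinMk, Fin.zero_eta, Fin.mk_one,
    Matrix.cons_val, Finset.sum_empty, Finset.sum_singleton, Finset.sum_insert,
    Finset.mem_singleton, Fin.reduceEq, not_false_eq_true]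
  · ring
  · linear_combination h.x_sq
  · linear_combination h.x_mul_y
  · linear_combination h.x_mul_z
  · linear_combination h.x_mul_y_sq
  · linear_combination z * h.x_mul_y
  · linear_combination z * h.x_mul_z
  · linear_combination z * h.x_mul_y_sq
  · linear_combination z ^ 2 * h.x_mul_y + h.y_sq_mul_z_cube
  · linear_combination h.x_mul_z_cube
  · linear_combination z ^ 2 * h.x_mul_y_sq
  · linear_combination z * h.x_mul_z_cube
  · linear_combination z ^ 2 * h.x_mul_z_cube

theorem y_mul_monomial₃ (i : Fin 13) : y * monomial₃ x y z (standardExponent i) =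
    ∑ j ∈ ![{2}, {7, 9}, {4}, {5}, {7, 9, 10}, {7}, {8}, {10, 11}, {10}, {10, 11}, {12}, {12}, ∅] i,
      monomial₃ x y z (standardExponent j) := by
  fin_cases i <;> simp only [monomial₃, standardExponent, Fin.reduceFinMk, Fin.zero_eta, Fin.mk_one,
    Matrix.cons_val, Finset.sum_empty, Finset.sum_singleton, Finset.sum_insert, Finset.mem_insert,
    Finset.mem_singleton, Fin.reduceEq, or_self, not_false_eq_true]
  · ring
  · linear_combination h.x_mul_y
  · ring
  · ring
  · linear_combination h.y_cube
  · ring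
  · ring
  · linear_combination h.y_cube_mul_z
  · ring
  · linear_combination h.y_mul_z_cube
  · linear_combination h.y_cube_mul_z_sq
  · linear_combination h.y_mul_z_pow_four
  · linear_combination z * h.y_mul_z_pow_four + h.z_pow_six

theorem z_mul_monomial₃ (i : Fin 13) : z * monomial₃ x y z (standardExponent i) =
    ∑ j ∈ ![{3}, {7}, {5}, {6}, {7}, {8}, {9}, {10}, {10, 11}, {11}, ∅, {12}, ∅] i,
      monomial₃ x y z (standardExponent j) := by
  fin_cases i <;> simp only [monomial₃, standardExponent, Fin.reduceFinMk, Fin.zero_eta, Fin.mk_one,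
    Matrix.cons_val, Finset.sum_empty, Finset.sum_singleton, Finset.sum_insert,
    Finset.mem_singleton, Fin.reduceEq, not_false_eq_true]
  · ring
  · linear_combination h.x_mul_z
  · ring
  · ring
  · ring
  · ring
  · ring
  · ring
  · linear_combination h.y_mul_z_cube
  · ring
  · linear_combination h.y_sq_mul_z_cube
  · ring
  · linear_combination h.z_pow_six

end ReducedRelations

theorem reducedRelations_of_map_eq_zero {A : Type*} [CommRing A] [Algebra (ZMod 2) A]
    {π : F2xyz →ₐ[ZMod 2] A} (hπ : ∀ i, π (reducedGenerators i) = 0) :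
    ReducedRelations (π (X 0)) (π (X 1)) (π (X 2)) := by
  have h₂ := two_eq_zero_of_algebra_zmod_two A
  have g₀ := hπ 0
  have g₁ := hπ 1
  have g₂ := hπ 2
  have g₃ := hπ 3
  have g₄ := hπ 4
  simp only [reducedGenerators, Matrix.cons_val, map_add, map_mul, map_pow]
    at g₀ g₁ g₂ g₃ g₄
  exact
    { two_eq_zero := h₂
      x_sq := g₀
      x_mul_z := by linear_combination g₁ - π (X 1) ^ 2 * π (X 2) * h₂
      x_mul_y := by linear_combination g₂ - g₁ - π (X 2) ^ 3 * h₂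
      y_cube := by
        linear_combination g₃ - (π (X 2) ^ 3 + π (X 1) ^ 2 * π (X 2) +
          π (X 1) ^ 2 * π (X 2) ^ 2) * h₂
      x_mul_y_sq := g₄ }

theorem span_range_monomial₃_standardExponent {k A : Type*} [CommRing k] [CommRing A] [Algebra k A]
    {π : MvPowerSeries (Fin 3) k →ₐ[k] A} (hπ : Function.Surjective π)
    (h : ReducedRelations (π (X 0)) (π (X 1)) (π (X 2))) :
    Submodule.span k (Set.range fun i =>
      monomial₃ (π (X 0)) (π (X 1)) (π (X 2)) (standardExponent i)) = ⊤ := by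
  set b := fun i => monomial₃ (π (X 0)) (π (X 1)) (π (X 2)) (standardExponent i)
  have hb (i) : b i ∈ Submodule.span k (Set.range b) := Submodule.subset_span ⟨i, rfl⟩
  have mul_mem_span {a : A} (ha : ∀ i, ∃ s : Finset (Fin 13), a * b i = ∑ j ∈ s, b j) :
      ∀ w ∈ Submodule.span k (Set.range b), a * w ∈ Submodule.span k (Set.range b) := by
    intro w hw
    refine Submodule.span_le (p := (Submodule.span k (Set.range b)).comap
      (LinearMap.mulLeft k a)).2 ?_ hw
    rintro _ ⟨i, rfl⟩
    obtain ⟨s, hs⟩ := ha i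
    rw [SetLike.mem_coe, Submodule.mem_comap, LinearMap.mulLeft_apply, hs]
    exact sum_mem fun j _ => hb j
  refine eq_top_of_X_mul_mem hπ ?_ ?_ ?_
  · simp only [Fin.forall_fin_succ]
    exact ⟨⟨2, h.x_sq⟩, ⟨5, h.y_pow_five⟩, ⟨6, h.z_pow_six⟩, fun i => i.elim0⟩
  · simpa [b, monomial₃, standardExponent] using hb 0
  · simp only [Fin.forall_fin_succ]
    exact ⟨mul_mem_span fun i => ⟨_, h.x_mul_monomial₃ i⟩,
      mul_mem_span fun i => ⟨_, h.y_mul_monomial₃ i⟩,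
      mul_mem_span fun i => ⟨_, h.z_mul_monomial₃ i⟩, fun i => i.elim0⟩

/-- A linear form that cuts out `idealI` by apolarity: `idealI = formIdeal dualForm`. -/
noncomputable def dualForm : F2xyz →ₗ[ZMod 2] ZMod 2 :=
  coeff₃ 0 0 5 + coeff₃ 0 4 0 + coeff₃ 0 3 2 + coeff₃ 0 1 4 + coeff₃ 1 1 2

theorem dualForm_monomial₃ (e : ℕ × ℕ × ℕ) :
    dualForm (monomial₃ (X 0) (X 1) (X 2) e) =
      if e ∈ [(0, 0, 5), (0, 4, 0), (0, 3, 2), (0, 1, 4), (1, 1, 2)] then 1 else 0 := by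
  simp only [dualForm, LinearMap.add_apply, coeff₃_monomial₃]
  grind

theorem idealI_le_formIdeal_dualForm : idealI ≤ formIdeal dualForm := by
  rw [idealI_eq_span_reducedGenerators, Ideal.span_le, Set.range_subset_iff]
  intro i a
  fin_cases i <;>
    simp [reducedGenerators, dualForm, mul_comm a, add_mul, pow_succ, mul_assoc,
      coeff₃_X_zero_mul, coeff₃_X_one_mul, coeff₃_X_two_mul] <;> grind

/-- The supports of the polynomials that are dual to the standard monomials under the pairing
`(f, g) ↦ dualForm (f * g)`. -/
def dualSupport : Fin 13 → Finset (ℕ × ℕ × ℕ) :=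
  ![{(0, 0, 5)}, {(1, 0, 0), (0, 2, 0), (0, 1, 2), (0, 0, 3), (0, 2, 1)}, {(0, 2, 2)},
    {(0, 0, 4), (0, 2, 2)}, {(1, 0, 0), (0, 2, 0)}, {(0, 2, 1)}, {(0, 0, 3), (0, 2, 1)},
    {(1, 0, 0), (0, 1, 1), (0, 0, 2)}, {(1, 0, 0)}, {(1, 0, 0), (0, 0, 2)},
    {(0, 1, 0), (0, 0, 1)}, {(0, 0, 1)}, {(0, 0, 0)}]

theorem dualForm_sum_dualSupport_mul (i j : Fin 13) :
    dualForm ((∑ d ∈ dualSupport i, monomial₃ (X 0) (X 1) (X 2) d) *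
      monomial₃ (X 0) (X 1) (X 2) (standardExponent j)) = if i = j then 1 else 0 := by
  simp only [Finset.sum_mul, map_sum, ← monomial₃_add, dualForm_monomial₃]
  revert i j
  decide

/-- The linear forms on `idealI` dual to its five generators modulo the maximal ideal. -/
noncomputable def generatorForms : F2xyz →ₗ[ZMod 2] (Fin 5 → ZMod 2) :=
  LinearMap.pi ![coeff₃ 2 0 0, coeff₃ 1 0 1 + coeff₃ 1 1 0, coeff₃ 1 1 0, coeff₃ 0 3 0,
    coeff₃ 1 2 0 + coeff₃ 0 1 3 + coeff₃ 1 1 2 + coeff₃ 0 0 5 + coeff₃ 0 1 4 + coeff₃ 0 3 2]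

theorem generatorForms_mul_reducedGenerators (i : Fin 5) (a : F2xyz) :
    generatorForms (a * reducedGenerators i) = Pi.single i (constantCoeff a) := by
  ext j
  fin_cases i <;> fin_cases j <;>
    simp [reducedGenerators, generatorForms, mul_comm a, add_mul, pow_succ, mul_assoc,
      coeff₃_X_zero_mul, coeff₃_X_one_mul, coeff₃_X_two_mul, coeff₃_zero] <;> grind

theorem reducedRelations_mk_idealI :
    ReducedRelations (Ideal.Quotient.mkₐ (ZMod 2) idealI (X 0))
      (Ideal.Quotient.mkₐ (ZMod 2) idealI (X 1)) (Ideal.Quotient.mkₐ (ZMod 2) idealI (X 2)) :=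
  reducedRelations_of_map_eq_zero fun i => Ideal.Quotient.eq_zero_iff_mem.2 <|
    idealI_eq_span_reducedGenerators ▸ Ideal.subset_span ⟨i, rfl⟩

theorem span_range_mk_monomial₃_standardExponent :
    Submodule.span (ZMod 2) (Set.range (Ideal.Quotient.mkₐ (ZMod 2) idealI ∘ fun i =>
      monomial₃ (X 0) (X 1) (X 2) (standardExponent i))) = ⊤ := by
  rw [← span_range_monomial₃_standardExponent (Ideal.Quotient.mkₐ_surjective (ZMod 2) idealI)
    reducedRelations_mk_idealI]
  simp only [Function.comp_def, monomial₃, map_mul, map_pow]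

theorem idealI_eq_formIdeal_dualForm : idealI = formIdeal dualForm :=
  le_antisymm idealI_le_formIdeal_dualForm <| formIdeal_le_of_dual_family
    idealI_le_formIdeal_dualForm span_range_mk_monomial₃_standardExponent
    dualForm_sum_dualSupport_mul

theorem dualForm_ne_zero : dualForm ≠ 0 := fun h => by
  simpa [h] using dualForm_sum_dualSupport_mul 0 0

theorem isGorensteinIdeal_idealI : IsGorensteinIdeal idealI := by
  have : Module.Finite (ZMod 2) (F2xyz ⧸ idealI) :=
    ⟨span_range_mk_monomial₃_standardExponent ▸ Submodule.fg_span (Set.finite_range _)⟩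
  rw [idealI_eq_formIdeal_dualForm] at this ⊢
  exact isGorensteinIdeal_formIdeal dualForm_ne_zero

theorem spanRank_idealI : idealI.spanRank = 5 := by
  rw [idealI_eq_span_reducedGenerators]
  simpa using spanRank_span_range_of_dual_forms (ε := constantCoeff)
    (fun c => ⟨C c, constantCoeff_C c⟩) generatorForms.toAddMonoidHom
    generatorForms_mul_reducedGenerators

theorem idealGrade_idealI_le : idealGrade idealI ≤ 3 := by
  have hne : idealI ≠ ⊤ := idealI_eq_formIdeal_dualForm ▸ formIdeal_ne_top dualForm_ne_zero
  have hdim := ringKrullDim_mvPowerSeries_le (Fin 3) (ZMod 2)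
  rw [Nat.card_fin] at hdim
  exact WithBot.coe_le_coe.1 ((idealGrade_le_ringKrullDim hne).trans hdim)

theorem le_idealGrade_idealI : 3 ≤ idealGrade idealI := by
  have hreg := isWeaklyRegular_map_X_pow (k := ZMod 2) (List.nodup_finRange 3) ![2, 5, 6]
  refine le_iSup₂_of_le _ ?_ (le_iSup_of_le hreg (by simp))
  have mem_of_mk_eq_zero {f : F2xyz} (hf : Ideal.Quotient.mkₐ (ZMod 2) idealI f = 0) :
      f ∈ idealI := Ideal.Quotient.eq_zero_iff_mem.1 hf
  have h := reducedRelations_mk_idealI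
  rw [List.forall_mem_map]
  intro i _
  fin_cases i
  exacts [mem_of_mk_eq_zero ((map_pow _ _ _).trans h.x_sq),
    mem_of_mk_eq_zero ((map_pow _ _ _).trans h.y_pow_five),
    mem_of_mk_eq_zero ((map_pow _ _ _).trans h.z_pow_six)]

theorem mainTheorem4 :
    IsGorensteinIdeal idealI ∧ idealGrade idealI = 3 ∧ Submodule.spanRank idealI = 5 :=
  ⟨isGorensteinIdeal_idealI, le_antisymm idealGrade_idealI_le le_idealGrade_idealI,
    spanRank_idealI⟩
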